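/- For complex $a,q$ with $|q|<1$ and an integer $n\ge 0$ write $(a;q)_n=\prod_{j=0}^{n-1}(1-aq^j)$ and $(a;q)_\infty=\prod_{j=0}^{\infty}(1-aq^j)$. An overpartition is a partition in which the first occurrence of each part may be overlined (it may be empty); it has distinct parts if its non-overlined parts are distinct too. An overpartition pair of $n$ is a pair $\pi=(\lambda_1,\lambda_2)$ of overpartitions such that the sum of all the parts of $\lambda_1$ and $\lambda_2$ is $n$; it has distinct parts if both $\lambda_1$ and $\lambda_2$ do. For $n\ge1$ consider the overpartition pairs $\pi=(\lambda_1,\lambda_2)$ of $n$ into distinct parts such that the smallest part $s$ of $\pi$ is the smallest part of $\lambda_1$ and occurs overlined in $\lambda_1$, the non-overlined parts of $\lambda_1$ and the overlined parts of $\lambda_2$ are $>s$, and the non-overlined parts of $\lambda_2$ lie in the interval $[s,2s)$. Let $A_2(n)$ (resp. $A_3(n)$) be the number of these pairs in which the number of non-overlined parts is even (resp. odd), and let $A''(n)=A_2(n)-A_3(n)$. Theorem. For every complex $q$ with $|q|<1$ the three series below converge absolutely and $$\sum_{n=1}^\infty A''(n)\,q^n=\sum_{n=1}^\infty q^n(-q^{n+1};q)_\infty^2(q^{n+1};q)_\infty(q^n;q)_n=\sum_{n=1}^\infty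 n\,q^{n(n+1)/2}.$$ -/

import Mathlib

/-- The finite `q`-shifted factorial `(a;q)_n = ∏_{j<n} (1 - a q^j)`. -/
noncomputable def qPoch (a q : ℂ) (n : ℕ) : ℂ :=
  ∏ j ∈ Finset.range n, (1 - a * q ^ j)

/-- The infinite `q`-shifted factorial `(a;q)_∞ = ∏_{j≥0} (1 - a q^j)`. -/
noncomputable def qPochInf (a q : ℂ) : ℂ :=
  ∏' j : ℕ, (1 - a * q ^ j)

/-- The infinite product defining `(a;q)_∞` converges for `|q| < 1`. -/
theorem multipliable_qPochInf (a q : ℂ) (hq : ‖q‖ < 1) :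
    Multipliable (fun j : ℕ => 1 - a * q ^ j) := by
  have h : Summable (fun j : ℕ => ‖-(a * q ^ j)‖) := by
    simp only [norm_neg, norm_mul, norm_pow]
    exact (summable_geometric_of_lt_one (norm_nonneg q) hq).mul_left _
  simpa [sub_eq_add_neg] using multipliable_one_add_of_summable h

/-- An overpartition: a partition in which the first occurrence of each part may be overlined.
It is recorded by the set of its overlined parts (at most one overlined copy of each size) and the
multiset of its non-overlined parts, all of them positive. -/
@[ext]
structure Overpartition where
  /-- the overlined parts -/
  overlined : Finset ℕ
  /-- the non-overlined parts -/
  plain : Multiset ℕ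
  overlined_pos : ∀ p ∈ overlined, 0 < p
  plain_pos : ∀ p ∈ plain, 0 < p

namespace Overpartition

/-- The multiset of all parts, overlined or not. -/
def parts (l : Overpartition) : Multiset ℕ := l.overlined.val + l.plain

/-- The number partitioned: the sum of all parts. -/
def size (l : Overpartition) : ℕ := l.parts.sum

/-- An overpartition has distinct parts if its non-overlined parts are distinct too. -/
def HasDistinctParts (l : Overpartition) : Prop := l.plain.Nodup

end Overpartition

/-- `s` is the smallest element of the multiset `m` (in particular `m` is nonempty). -/
def IsSmallestPart (s : ℕ) (m : Multiset ℕ) : Prop := s ∈ m ∧ ∀ p ∈ m, s ≤ p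

/-- Overpartition pairs `π = (λ₁, λ₂)`. -/
abbrev OverpartitionPair := Overpartition × Overpartition

namespace OverpartitionPair

/-- The number partitioned by a pair: the sum of all the parts of both components. -/
def size (π : OverpartitionPair) : ℕ := π.1.size + π.2.size

/-- A pair has distinct parts if both of its components do. -/
def HasDistinctParts (π : OverpartitionPair) : Prop :=
  π.1.HasDistinctParts ∧ π.2.HasDistinctParts

/-- The number of non-overlined parts of a pair. -/
def numPlain (π : OverpartitionPair) : ℕ := π.1.plain.card + π.2.plain.card

end OverpartitionPair

/-- The overpartition pairs `π = (λ₁, λ₂)` of `n` into distinct parts whose smallest part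
`s = s(π)` is the smallest part of `λ₁` and occurs overlined in `λ₁`, while the non-overlined parts
of `λ₁` and the overlined parts of `λ₂` are `> s` and the non-overlined parts of `λ₂` lie in
`[s, 2s)`. The second component may be empty. -/
def pairsA (n : ℕ) : Set OverpartitionPair :=
  {π | π.size = n ∧ π.HasDistinctParts ∧
    ∃ s : ℕ, IsSmallestPart s (π.1.parts + π.2.parts) ∧ IsSmallestPart s π.1.parts ∧
      s ∈ π.1.overlined ∧
      (∀ p ∈ π.1.plain, s < p) ∧
      (∀ p ∈ π.2.overlined, s < p) ∧
      (∀ p ∈ π.2.plain, s ≤ p ∧ p < 2 * s)}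

/-- The number of pairs in `pairsA n` with an even number of non-overlined parts. -/
noncomputable def A₂ (n : ℕ) : ℕ := {π ∈ pairsA n | Even π.numPlain}.ncard

/-- The number of pairs in `pairsA n` with an odd number of non-overlined parts. -/
noncomputable def A₃ (n : ℕ) : ℕ := {π ∈ pairsA n | Odd π.numPlain}.ncard

/-- The signed count `A₂(n) - A₃(n)`. -/
noncomputable def signedA (n : ℕ) : ℤ := (A₂ n : ℤ) - (A₃ n : ℤ)

/-- The sets counted by `A₂` and `A₃` are finite, so that `Set.ncard` is their cardinality. -/
theorem finite_pairsA (n : ℕ) : (pairsA n).Finite := by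
  have key : ∀ π ∈ pairsA n, ∀ p ∈ π.1.parts + π.2.parts, p ≤ n := by
    intro π hπ p hp
    have h := Multiset.single_le_sum (fun x _ => Nat.zero_le x) p hp
    rw [Multiset.sum_add] at h
    exact h.trans (le_of_eq hπ.1)
  let f : OverpartitionPair → (Finset ℕ × Finset ℕ) × (Finset ℕ × Finset ℕ) := fun π =>
    ((π.1.overlined, π.1.plain.toFinset), (π.2.overlined, π.2.plain.toFinset))
  let P := ((Finset.range (n + 1)).powerset : Set (Finset ℕ))
  refine Set.Finite.of_finite_image (f := f) (Set.Finite.subset (s := (P ×ˢ P) ×ˢ (P ×ˢ P)) ?_ ?_) ?_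
  · exact ((Finset.finite_toSet _).prod (Finset.finite_toSet _)).prod
      ((Finset.finite_toSet _).prod (Finset.finite_toSet _))
  · rintro _ ⟨π, hπ, rfl⟩
    have k := key π hπ
    simp only [Overpartition.parts, Multiset.mem_add, Finset.mem_val] at k
    simp only [f, P, Set.mem_prod, Finset.mem_coe, Finset.mem_powerset, Finset.subset_iff,
      Finset.mem_range, Nat.lt_succ_iff, Multiset.mem_toFinset]
    grind
  · intro π hπ ρ hρ h
    simp only [f, Prod.mk.injEq] at h
    obtain ⟨⟨h1, h2⟩, h3, h4⟩ := h
    have e : ∀ a b : Multiset ℕ, a.Nodup → b.Nodup → a.toFinset = b.toFinset → a = b := by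
      intro a b ha hb hab
      refine (Multiset.Nodup.ext ha hb).mpr fun x => ?_
      rw [← Multiset.mem_toFinset, hab, Multiset.mem_toFinset]
    exact Prod.ext (Overpartition.ext h1 (e _ _ hπ.2.1.1 hρ.2.1.1 h2))
      (Overpartition.ext h3 (e _ _ hπ.2.1.2 hρ.2.1.2 h4))

/-!
The middle series is evaluated with the partial theta function `θ(a) = ∑ (-a)^n q^{n(n-1)/2}`,
which satisfies `θ(a) + a θ(aq) = 1`.

The product formula of Andrews and Warnaar (`thetaProd_eq_mul`),
`θ(a) θ(b) = ∑ q^n (q^{n+1})_∞ (aq^n)_∞ (bq^n)_∞ (abq^{n-1})_n`, holds because the right side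
`Φ(a, b)` satisfies the product of the two functional equations: the combination
`Φ(a, b) + a Φ(aq, b) + b Φ(a, bq) + ab Φ(aq, bq)` telescopes to `1` (`sum_thetaProdTerm`), and the
homogeneous equation `f(x) = -x f(xq)` has only the zero solution among functions bounded along
`x, xq, xq², …` (`eq_zero_of_eq_neg_mul`).

Put `Y(a, b) = ∑ q^n (q^{n+1})_∞ (aq^{n+1})_∞ (bq^{n+1})_∞ (abq^n)_n`. Termwise,
`(a - b) Y(a, b) = a Φ(aq, b) - b Φ(a, bq)`, and by the product formula and the functional equation
this equals `θ(b) - θ(a)` (`sub_mul_tsum_thetaDiffTerm`). Letting `a` tend to `b = -1` gives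
`Y(-1, -1) = ∑ n q^{n(n-1)/2} = ∑ (n + 1) q^{n(n+1)/2}`. For `n ≥ 1` the terms of `Y(-1, -1)` are
those of the middle series; the term `n = 0` is `(q)_∞ (-q)_∞²`, which is `∑ q^{n(n+1)/2}` by Gauss
(`gauss_triangular`). Subtracting it leaves `∑ n q^{n(n+1)/2}`.

For the first equality, a pair counted by `pairsA` amounts to its smallest part `s` and four finite
sets of further parts (`PairData.bijOn_ofPair`), three of them in `(s, ∞)` and one in `[s, 2s)`. The
absolutely convergent sum of the signed weights over all these data is computed in two ways: with
`s` fixed the four sums expand the four products (`PairData.tsum_weight`), and grouping by the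
number partitioned gives the generating function of `signedA` (`hasSum_signedA`).
-/

open Filter Topology

/-! ### Shifted factorials: bounds, continuity, recurrences -/

theorem tendsto_qPoch_qPochInf (a : ℂ) {q : ℂ} (hq : ‖q‖ < 1) :
    Tendsto (qPoch a q) atTop (𝓝 (qPochInf a q)) :=
  (multipliable_qPochInf a q hq).hasProd.tendsto_prod_nat

theorem norm_qPoch_sub_one_le (a : ℂ) {q : ℂ} (hq : ‖q‖ < 1) (n : ℕ) :
    ‖qPoch a q n - 1‖ ≤ Real.exp (‖a‖ / (1 - ‖q‖)) - 1 := by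
  have h := Finset.norm_prod_one_add_sub_one_le (Finset.range n) fun j => -(a * q ^ j)
  simp only [← sub_eq_add_neg, norm_neg, norm_mul, norm_pow, ← Finset.mul_sum] at h
  refine h.trans ?_
  rw [div_eq_mul_inv, ← tsum_geometric_of_lt_one (norm_nonneg q) hq]
  gcongr
  exact (summable_geometric_of_lt_one (norm_nonneg q) hq).sum_le_tsum _
    fun _ _ => pow_nonneg (norm_nonneg q) _

theorem norm_qPochInf_sub_one_le (a : ℂ) {q : ℂ} (hq : ‖q‖ < 1) :
    ‖qPochInf a q - 1‖ ≤ Real.exp (‖a‖ / (1 - ‖q‖)) - 1 :=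
  le_of_tendsto ((tendsto_qPoch_qPochInf a hq).sub_const 1).norm
    (Eventually.of_forall fun n => norm_qPoch_sub_one_le a hq n)

theorem norm_le_exp_of_norm_sub_one_le {x a q : ℂ} {R : ℝ} (hq : ‖q‖ < 1) (ha : ‖a‖ ≤ R)
    (h : ‖x - 1‖ ≤ Real.exp (‖a‖ / (1 - ‖q‖)) - 1) : ‖x‖ ≤ Real.exp (R / (1 - ‖q‖)) := by
  have h1 : ‖x‖ ≤ ‖x - 1‖ + 1 := by simpa using norm_add_le (x - 1) 1
  have h2 : 0 < 1 - ‖q‖ := by linarith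
  have h3 : Real.exp (‖a‖ / (1 - ‖q‖)) ≤ Real.exp (R / (1 - ‖q‖)) := by gcongr
  linarith

theorem norm_qPoch_le {a q : ℂ} {R : ℝ} (hq : ‖q‖ < 1) (ha : ‖a‖ ≤ R) (n : ℕ) :
    ‖qPoch a q n‖ ≤ Real.exp (R / (1 - ‖q‖)) :=
  norm_le_exp_of_norm_sub_one_le hq ha (norm_qPoch_sub_one_le a hq n)

theorem norm_qPochInf_le {a q : ℂ} {R : ℝ} (hq : ‖q‖ < 1) (ha : ‖a‖ ≤ R) :
    ‖qPochInf a q‖ ≤ Real.exp (R / (1 - ‖q‖)) :=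
  norm_le_exp_of_norm_sub_one_le hq ha (norm_qPochInf_sub_one_le a hq)

theorem tendsto_one_of_norm_sub_one_le {u v : ℕ → ℂ} {q : ℂ} (hu : Tendsto u atTop (𝓝 0))
    (h : ∀ n, ‖v n - 1‖ ≤ Real.exp (‖u n‖ / (1 - ‖q‖)) - 1) : Tendsto v atTop (𝓝 1) := by
  rw [tendsto_iff_norm_sub_tendsto_zero]
  refine squeeze_zero (fun _ => norm_nonneg _) h ?_
  have h1 : Tendsto (fun n => Real.exp (‖u n‖ / (1 - ‖q‖)) - 1) atTop
      (𝓝 (Real.exp (‖(0 : ℂ)‖ / (1 - ‖q‖)) - 1)) :=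
    ((Real.continuous_exp.tendsto _).comp (hu.norm.div_const _)).sub_const 1
  simpa using h1

theorem continuous_qPochInf {q : ℂ} (hq : ‖q‖ < 1) : Continuous fun a => qPochInf a q := by
  rw [continuous_iff_continuousAt]
  intro a
  have h := tendsto_tprod_one_add_of_dominated_convergence (𝓕 := 𝓝 a)
    (f := fun x (j : ℕ) => -(x * q ^ j)) (g := fun j => -(a * q ^ j))
    (bound := fun j => (‖a‖ + 1) * ‖q‖ ^ j)
    ((summable_geometric_of_lt_one (norm_nonneg q) hq).mul_left _)
    (fun k => (continuous_id.mul continuous_const).neg.tendsto a) ?_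
  · simpa only [ContinuousAt, qPochInf, ← sub_eq_add_neg] using h
  · have h1 : ∀ᶠ x in 𝓝 a, ‖x‖ < ‖a‖ + 1 :=
      continuous_norm.continuousAt.eventually_lt continuousAt_const (lt_add_one ‖a‖)
    filter_upwards [h1] with x hx k
    rw [norm_neg, norm_mul, norm_pow]
    gcongr

theorem continuous_qPoch (q : ℂ) (n : ℕ) : Continuous fun a => qPoch a q n := by
  unfold qPoch
  fun_prop

theorem qPochInf_eq_mul (a : ℂ) {q : ℂ} (hq : ‖q‖ < 1) :
    qPochInf a q = (1 - a) * qPochInf (a * q) q := by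
  unfold qPochInf
  have h := multipliable_qPochInf (a * q) q hq
  rw [tprod_eq_zero_mul']
  · simp only [pow_zero, mul_one, pow_succ', mul_assoc]
  · simpa only [pow_succ', mul_assoc] using h

@[simp]
theorem qPoch_zero (a q : ℂ) : qPoch a q 0 = 1 := by simp [qPoch]

@[simp]
theorem qPoch_zero_left (q : ℂ) (n : ℕ) : qPoch 0 q n = 1 := by simp [qPoch]

@[simp]
theorem qPochInf_zero_left (q : ℂ) : qPochInf 0 q = 1 := by simp [qPochInf]

theorem qPoch_succ (a q : ℂ) (n : ℕ) : qPoch a q (n + 1) = qPoch a q n * (1 - a * q ^ n) :=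
  Finset.prod_range_succ _ _

theorem qPoch_succ' (a q : ℂ) (n : ℕ) : qPoch a q (n + 1) = (1 - a) * qPoch (a * q) q n := by
  simp only [qPoch, Finset.prod_range_succ', pow_zero, mul_one, pow_succ', mul_assoc]
  rw [mul_comm]

/-! ### Partial theta functions -/

/-- The partial theta function `θ(a) = ∑_{n ≥ 0} (-a)^n q^{n(n-1)/2}`. -/
noncomputable def partialTheta (q a : ℂ) : ℂ := ∑' n : ℕ, (-a) ^ n * q ^ n.choose 2

/-- Super-geometric decay of `q^{n(n-1)/2}`, with room for the factor `n` that differentiation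
produces. -/
theorem summable_mul_pow_mul_pow_choose {q : ℂ} (hq : ‖q‖ < 1) (r : ℝ) :
    Summable fun n : ℕ => (n + 1 : ℝ) * r ^ n * ‖q‖ ^ n.choose 2 := by
  have h0 : Tendsto (fun n : ℕ => 2 * |r| * ‖q‖ ^ n) atTop (𝓝 (2 * |r| * 0)) :=
    (tendsto_pow_atTop_nhds_zero_of_lt_one (norm_nonneg q) hq).const_mul _
  rw [mul_zero] at h0
  refine summable_of_ratio_norm_eventually_le (r := 1 / 2) (by norm_num) ?_
  filter_upwards [h0.eventually_lt_const (show (0 : ℝ) < 1 / 2 by norm_num)] with n hn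
  have e : (n + 1).choose 2 = n + n.choose 2 := by rw [Nat.choose_succ_succ' n 1]; simp
  rw [e]
  simp only [norm_mul, norm_pow, Real.norm_eq_abs, abs_norm, pow_succ, pow_add]
  have e1 : |((n + 1 : ℕ) : ℝ) + 1| = n + 2 := by
    rw [abs_of_nonneg (by positivity)]; push_cast; ring
  have e2 : |(n : ℝ) + 1| = n + 1 := abs_of_nonneg (by positivity)
  rw [e1, e2]
  have h1 : (n + 2 : ℝ) * (|r| ^ n * |r|) * (‖q‖ ^ n * ‖q‖ ^ n.choose 2) ≤
      (2 * (n + 1) : ℝ) * (|r| ^ n * |r|) * (‖q‖ ^ n * ‖q‖ ^ n.choose 2) := by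
    gcongr
    linarith
  refine h1.trans ?_
  have h2 : (2 * (n + 1) : ℝ) * (|r| ^ n * |r|) * (‖q‖ ^ n * ‖q‖ ^ n.choose 2) =
      (2 * |r| * ‖q‖ ^ n) * ((n + 1) * |r| ^ n * ‖q‖ ^ n.choose 2) := by ring
  rw [h2]
  gcongr

theorem summable_partialTheta {q : ℂ} (hq : ‖q‖ < 1) (a : ℂ) :
    Summable fun n : ℕ => (-a) ^ n * q ^ n.choose 2 := by
  refine (summable_mul_pow_mul_pow_choose hq ‖a‖).of_norm_bounded fun n => ?_
  rw [norm_mul, norm_pow, norm_pow, norm_neg, mul_assoc]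
  exact le_mul_of_one_le_left (by positivity) (by linarith [n.cast_nonneg (α := ℝ)])

theorem partialTheta_eq {q : ℂ} (hq : ‖q‖ < 1) (a : ℂ) :
    partialTheta q a = 1 - a * partialTheta q (a * q) := by
  unfold partialTheta
  rw [(summable_partialTheta hq a).tsum_eq_zero_add, ← tsum_mul_left, sub_eq_add_neg, ← tsum_neg]
  congr 1
  · simp
  · refine tsum_congr fun n => ?_
    have e : (n + 1).choose 2 = n + n.choose 2 := by rw [Nat.choose_succ_succ' n 1]; simp
    rw [e, pow_add, pow_succ, ← neg_mul a q, mul_pow]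
    ring

theorem norm_partialTheta_le {q : ℂ} (hq : ‖q‖ < 1) {a : ℂ} {R : ℝ} (ha : ‖a‖ ≤ R) :
    ‖partialTheta q a‖ ≤ ∑' n : ℕ, (n + 1 : ℝ) * R ^ n * ‖q‖ ^ n.choose 2 := by
  refine tsum_of_norm_bounded (summable_mul_pow_mul_pow_choose hq R).hasSum fun n => ?_
  have hR : 0 ≤ R := (norm_nonneg a).trans ha
  rw [norm_mul, norm_pow, norm_pow, norm_neg, mul_assoc]
  calc ‖a‖ ^ n * ‖q‖ ^ n.choose 2 ≤ R ^ n * ‖q‖ ^ n.choose 2 := by gcongr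
    _ ≤ _ := le_mul_of_one_le_left (by positivity) (by linarith [n.cast_nonneg (α := ℝ)])

/-- The homogeneous form `f(x) = -x f(xq)` of the functional equation of `θ` has no nonzero
solution that is bounded along `x, xq, xq², …`: the factors `xq^k` are eventually at most `1/2`. -/
theorem eq_zero_of_eq_neg_mul {q : ℂ} (hq : ‖q‖ < 1) (f : ℂ → ℂ) (a : ℂ)
    (hf : ∀ x, f x = -x * f (x * q)) (hC : ∃ C, ∀ k : ℕ, ‖f (a * q ^ k)‖ ≤ C) : f a = 0 := by
  obtain ⟨C, hC⟩ := hC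
  have step : ∀ k : ℕ, f (a * q ^ k) = -(a * q ^ k) * f (a * q ^ (k + 1)) := fun k => by
    rw [hf (a * q ^ k), mul_assoc, ← pow_succ]
  have h0 : Tendsto (fun n : ℕ => ‖a‖ * ‖q‖ ^ n) atTop (𝓝 (‖a‖ * 0)) :=
    (tendsto_pow_atTop_nhds_zero_of_lt_one (norm_nonneg q) hq).const_mul _
  rw [mul_zero] at h0
  obtain ⟨K, hK⟩ := eventually_atTop.mp
    (h0.eventually_lt_const (show (0 : ℝ) < 1 / 2 by norm_num))
  have bound : ∀ m k : ℕ, K ≤ k → ‖f (a * q ^ k)‖ ≤ (1 / 2) ^ m * C := by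
    intro m
    induction m with
    | zero => intro k _; simpa using hC k
    | succ m ih =>
      intro k hk
      rw [step k, norm_mul, norm_neg, norm_mul, norm_pow, pow_succ' _ m, mul_assoc (1 / 2 : ℝ)]
      exact mul_le_mul (hK k hk).le (ih (k + 1) (by omega)) (norm_nonneg _) (by norm_num)
  have hzero : f (a * q ^ K) = 0 := by
    have h1 : Tendsto (fun m : ℕ => (1 / 2 : ℝ) ^ m * C) atTop (𝓝 (0 * C)) :=
      (tendsto_pow_atTop_nhds_zero_of_lt_one (by norm_num) (by norm_num)).mul_const C
    rw [zero_mul] at h1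
    exact norm_le_zero_iff.mp (ge_of_tendsto' h1 fun m => bound m K le_rfl)
  have down : ∀ k : ℕ, f (a * q ^ k) = 0 → f a = 0 := by
    intro k
    induction k with
    | zero => simp
    | succ k ih => intro h; exact ih (by rw [step k, h, mul_zero])
  exact down K hzero

/-! ### The product of two partial theta functions -/

/-- The `n`-th term of the Andrews-Warnaar series for `θ(a) θ(b)`. In the exponent `n - 1` the
truncation at `n = 0` is harmless, the finite product being empty there. -/
noncomputable def thetaProdTerm (q a b : ℂ) (n : ℕ) : ℂ :=
  q ^ n * qPochInf (q ^ (n + 1)) q * qPochInf (a * q ^ n) q * qPochInf (b * q ^ n) q *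
    qPoch (a * b * q ^ (n - 1)) q n

theorem norm_mul_pow_le {a q : ℂ} {R : ℝ} (hq : ‖q‖ < 1) (ha : ‖a‖ ≤ R) (n : ℕ) :
    ‖a * q ^ n‖ ≤ R := by
  rw [norm_mul, norm_pow]
  exact (mul_le_of_le_one_right (norm_nonneg a) (pow_le_one₀ (norm_nonneg q) hq.le)).trans ha

theorem norm_thetaProdTerm_le {q a b : ℂ} {R S : ℝ} (hq : ‖q‖ < 1) (ha : ‖a‖ ≤ R)
    (hb : ‖b‖ ≤ S) (n : ℕ) :
    ‖thetaProdTerm q a b n‖ ≤ ‖q‖ ^ n * (Real.exp (1 / (1 - ‖q‖)) * Real.exp (R / (1 - ‖q‖)) *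
      Real.exp (S / (1 - ‖q‖)) * Real.exp (R * S / (1 - ‖q‖))) := by
  have h1 : ‖q ^ (n + 1)‖ ≤ 1 := by
    rw [norm_pow]; exact pow_le_one₀ (norm_nonneg q) hq.le
  have h2 : ‖a * b‖ ≤ R * S := by
    rw [norm_mul]
    exact mul_le_mul ha hb (norm_nonneg b) ((norm_nonneg a).trans ha)
  unfold thetaProdTerm
  simp only [norm_mul, norm_pow q n, mul_assoc]
  gcongr
  · exact norm_qPochInf_le hq h1
  · exact norm_qPochInf_le hq (norm_mul_pow_le hq ha n)
  · exact norm_qPochInf_le hq (norm_mul_pow_le hq hb n)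
  · rw [← mul_assoc]
    exact norm_qPoch_le hq (norm_mul_pow_le hq h2 _) n

theorem summable_thetaProdTerm {q : ℂ} (hq : ‖q‖ < 1) (a b : ℂ) :
    Summable (thetaProdTerm q a b) :=
  ((summable_geometric_of_lt_one (norm_nonneg q) hq).mul_right _).of_norm_bounded
    fun n => norm_thetaProdTerm_le hq le_rfl le_rfl n

/-- The Andrews-Warnaar series
`∑ q^n (q^{n+1})_∞ (aq^n)_∞ (bq^n)_∞ (abq^{n-1})_n`. -/
noncomputable def thetaProd (q a b : ℂ) : ℂ := ∑' n, thetaProdTerm q a b n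

theorem norm_thetaProd_le {q a b : ℂ} {R S : ℝ} (hq : ‖q‖ < 1) (ha : ‖a‖ ≤ R) (hb : ‖b‖ ≤ S) :
    ‖thetaProd q a b‖ ≤ ∑' n : ℕ, ‖q‖ ^ n * (Real.exp (1 / (1 - ‖q‖)) *
      Real.exp (R / (1 - ‖q‖)) * Real.exp (S / (1 - ‖q‖)) * Real.exp (R * S / (1 - ‖q‖))) :=
  tsum_of_norm_bounded ((summable_geometric_of_lt_one (norm_nonneg q) hq).mul_right _).hasSum
    fun n => norm_thetaProdTerm_le hq ha hb n

/-- The partial sums of the combination of four series in `thetaProd_add_mul_eq_one`, in closed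
form. -/
theorem sum_thetaProdTerm {q : ℂ} (hq : ‖q‖ < 1) (a b : ℂ) (N : ℕ) :
    ∑ n ∈ Finset.range (N + 1), (thetaProdTerm q a b n + a * thetaProdTerm q (a * q) b n +
      b * (thetaProdTerm q a (b * q) n + a * thetaProdTerm q (a * q) (b * q) n)) =
    qPochInf (q ^ (N + 1)) q * qPochInf (a * q ^ (N + 1)) q * qPochInf (b * q ^ (N + 1)) q *
      qPoch (a * b * q ^ (N + 1)) q N := by
  induction N with
  | zero =>
    simp only [zero_add, Finset.sum_range_one, thetaProdTerm, pow_zero, pow_one, mul_one, one_mul,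
      qPoch_zero]
    rw [qPochInf_eq_mul a hq, qPochInf_eq_mul b hq]
    ring
  | succ n ih =>
    rw [Finset.sum_range_succ, ih]
    simp only [thetaProdTerm, Nat.add_sub_cancel]
    have hU : qPochInf (q ^ (n + 1)) q = (1 - q ^ (n + 1)) * qPochInf (q ^ (n + 1 + 1)) q := by
      rw [qPochInf_eq_mul _ hq, pow_succ _ (n + 1)]
    have hA : ∀ x : ℂ, qPochInf (x * q ^ (n + 1)) q =
        (1 - x * q ^ (n + 1)) * qPochInf (x * q ^ (n + 1 + 1)) q := fun x => by
      rw [qPochInf_eq_mul _ hq, pow_succ _ (n + 1), mul_assoc]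
    have hA' : ∀ x : ℂ, x * q * q ^ (n + 1) = x * q ^ (n + 1 + 1) := fun x => by ring
    have e1 : qPoch (a * b * q ^ n) q (n + 1) =
        (1 - a * b * q ^ n) * qPoch (a * b * q ^ (n + 1)) q n := by
      rw [qPoch_succ', pow_succ, mul_assoc (a * b)]
    have e2 : a * q * b * q ^ n = a * b * q ^ (n + 1) := by ring
    have e3 : a * (b * q) * q ^ n = a * b * q ^ (n + 1) := by ring
    have e4 : a * q * (b * q) * q ^ n = a * b * q ^ (n + 1 + 1) := by ring
    have e5 : qPoch (a * b * q ^ (n + 1)) q (n + 1) = qPoch (a * b * q ^ (n + 1)) q n *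
        (1 - a * b * q ^ (n + 1) * q ^ n) := qPoch_succ _ _ _
    have e6 : (1 - a * b * q ^ (n + 1)) * qPoch (a * b * q ^ (n + 1 + 1)) q (n + 1) =
        qPoch (a * b * q ^ (n + 1)) q n * (1 - a * b * q ^ (n + 1) * q ^ n) *
          (1 - a * b * q ^ (n + 1) * q ^ (n + 1)) := by
      rw [← qPoch_succ, ← qPoch_succ, qPoch_succ' _ _ (n + 1), pow_succ _ (n + 1),
        mul_assoc (a * b)]
    simp only [hA', e2, e3, e4, e1, e5]
    rw [hU, hA a, hA b]
    generalize qPochInf (q ^ (n + 1 + 1)) q = U at *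
    generalize qPochInf (a * q ^ (n + 1 + 1)) q = A at *
    generalize qPochInf (b * q ^ (n + 1 + 1)) q = B at *
    generalize qPoch (a * b * q ^ (n + 1 + 1)) q (n + 1) = T at *
    generalize qPoch (a * b * q ^ (n + 1)) q n = P at *
    -- `T` occurs in the goal only multiplied by `1 - a * b * q ^ (n + 1)`, so `e6` eliminates it
    -- without a division by that factor, which may vanish.
    linear_combination (-(U * A * B)) * e6

/-- The combination of four series that corresponds to
`(θ(a) + aθ(aq)) (θ(b) + bθ(bq)) = 1` telescopes. -/
theorem thetaProd_add_mul_eq_one {q : ℂ} (hq : ‖q‖ < 1) (a b : ℂ) :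
    thetaProd q a b + a * thetaProd q (a * q) b +
      b * (thetaProd q a (b * q) + a * thetaProd q (a * q) (b * q)) = 1 := by
  have hs : HasSum (fun n => thetaProdTerm q a b n + a * thetaProdTerm q (a * q) b n +
      b * (thetaProdTerm q a (b * q) n + a * thetaProdTerm q (a * q) (b * q) n)) _ :=
    ((summable_thetaProdTerm hq a b).hasSum.add
      ((summable_thetaProdTerm hq (a * q) b).hasSum.mul_left a)).add
    (((summable_thetaProdTerm hq a (b * q)).hasSum.add
      ((summable_thetaProdTerm hq (a * q) (b * q)).hasSum.mul_left a)).mul_left b)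
  refine tendsto_nhds_unique (hs.tendsto_sum_nat.comp (tendsto_add_atTop_nat 1)) ?_
  simp only [Function.comp_def, sum_thetaProdTerm hq]
  have hp : Tendsto (fun N : ℕ => q ^ (N + 1)) atTop (𝓝 0) :=
    (tendsto_pow_atTop_nhds_zero_of_norm_lt_one hq).comp (tendsto_add_atTop_nat 1)
  have hm : ∀ x : ℂ, Tendsto (fun N : ℕ => x * q ^ (N + 1)) atTop (𝓝 0) := fun x => by
    simpa using hp.const_mul x
  have h := (((tendsto_one_of_norm_sub_one_le hp fun n => norm_qPochInf_sub_one_le _ hq).mul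
    (tendsto_one_of_norm_sub_one_le (hm a) fun n => norm_qPochInf_sub_one_le _ hq)).mul
    (tendsto_one_of_norm_sub_one_le (hm b) fun n => norm_qPochInf_sub_one_le _ hq)).mul
    (tendsto_one_of_norm_sub_one_le (hm (a * b)) fun n => norm_qPoch_sub_one_le _ hq n)
  simpa using h

/-- The Andrews-Warnaar product formula for partial theta functions. -/
theorem thetaProd_eq_mul {q : ℂ} (hq : ‖q‖ < 1) (a b : ℂ) :
    thetaProd q a b = partialTheta q a * partialTheta q b := by
  have key : ∀ a b : ℂ, thetaProd q a b + a * thetaProd q (a * q) b = partialTheta q b := by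
    intro a b
    refine sub_eq_zero.mp (eq_zero_of_eq_neg_mul hq
      (fun x => thetaProd q a x + a * thetaProd q (a * q) x - partialTheta q x) b
      (fun x => ?_) ?_)
    · linear_combination thetaProd_add_mul_eq_one hq a x - partialTheta_eq hq x
    · have hb := norm_mul_pow_le hq (le_refl ‖b‖)
      exact ⟨_, fun k => (norm_sub_le _ _).trans (add_le_add ((norm_add_le _ _).trans (add_le_add
        (norm_thetaProd_le hq le_rfl (hb k)) ((norm_mul_le _ _).trans (mul_le_mul_of_nonneg_left
          (norm_thetaProd_le hq le_rfl (hb k)) (norm_nonneg a)))))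
        (norm_partialTheta_le hq (hb k)))⟩
  refine sub_eq_zero.mp (eq_zero_of_eq_neg_mul hq
    (fun x => thetaProd q x b - partialTheta q x * partialTheta q b) a (fun x => ?_) ?_)
  · linear_combination key x b - partialTheta q b * partialTheta_eq hq x
  · have ha := norm_mul_pow_le hq (le_refl ‖a‖)
    exact ⟨_, fun k => (norm_sub_le _ _).trans (add_le_add (norm_thetaProd_le hq (ha k) le_rfl)
      ((norm_mul_le _ _).trans (mul_le_mul_of_nonneg_right (norm_partialTheta_le hq (ha k))
        (norm_nonneg _))))⟩

/-! ### Divided differences of the partial theta function -/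

/-- The `n`-th term of the series for the divided difference `-(θ(a) - θ(b)) / (a - b)`. -/
noncomputable def thetaDiffTerm (q a b : ℂ) (n : ℕ) : ℂ :=
  q ^ n * qPochInf (q ^ (n + 1)) q * qPochInf (a * q ^ (n + 1)) q *
    qPochInf (b * q ^ (n + 1)) q * qPoch (a * b * q ^ n) q n

theorem norm_thetaDiffTerm_le {q a b : ℂ} {R S : ℝ} (hq : ‖q‖ < 1) (ha : ‖a‖ ≤ R)
    (hb : ‖b‖ ≤ S) (n : ℕ) :
    ‖thetaDiffTerm q a b n‖ ≤ ‖q‖ ^ n * (Real.exp (1 / (1 - ‖q‖)) * Real.exp (R / (1 - ‖q‖)) *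
      Real.exp (S / (1 - ‖q‖)) * Real.exp (R * S / (1 - ‖q‖))) := by
  have h1 : ‖q ^ (n + 1)‖ ≤ 1 := by
    rw [norm_pow]; exact pow_le_one₀ (norm_nonneg q) hq.le
  have h2 : ‖a * b‖ ≤ R * S := by
    rw [norm_mul]
    exact mul_le_mul ha hb (norm_nonneg b) ((norm_nonneg a).trans ha)
  unfold thetaDiffTerm
  simp only [norm_mul, norm_pow q n, mul_assoc]
  gcongr
  · exact norm_qPochInf_le hq h1
  · exact norm_qPochInf_le hq (norm_mul_pow_le hq ha _)
  · exact norm_qPochInf_le hq (norm_mul_pow_le hq hb _)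
  · rw [← mul_assoc]
    exact norm_qPoch_le hq (norm_mul_pow_le hq h2 _) n

theorem summable_thetaDiffTerm {q : ℂ} (hq : ‖q‖ < 1) (a b : ℂ) :
    Summable (thetaDiffTerm q a b) :=
  ((summable_geometric_of_lt_one (norm_nonneg q) hq).mul_right _).of_norm_bounded
    fun n => norm_thetaDiffTerm_le hq le_rfl le_rfl n

theorem sub_mul_thetaDiffTerm {q : ℂ} (hq : ‖q‖ < 1) (a b : ℂ) (n : ℕ) :
    (a - b) * thetaDiffTerm q a b n =
      a * thetaProdTerm q (a * q) b n - b * thetaProdTerm q a (b * q) n := by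
  have h1 : ∀ x : ℂ, qPochInf (x * q ^ n) q = (1 - x * q ^ n) * qPochInf (x * q ^ (n + 1)) q :=
    fun x => by rw [qPochInf_eq_mul _ hq, pow_succ, mul_assoc]
  have h2 : ∀ x : ℂ, x * q * q ^ n = x * q ^ (n + 1) := fun x => by ring
  have h3 : ∀ x : ℂ, qPoch (x * q * q ^ (n - 1)) q n = qPoch (x * q ^ n) q n := fun x => by
    cases n with
    | zero => simp
    | succ n => rw [Nat.add_sub_cancel, mul_assoc, pow_succ']
  have h4 : a * q * b = a * b * q := by ring
  simp only [thetaDiffTerm, thetaProdTerm, h4, ← mul_assoc a b q, h3, h2, h1 a, h1 b]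
  ring

/-- The four products of partial theta functions that arise from the product formula collapse, by
the functional equation of `θ`, to a difference. -/
theorem sub_mul_tsum_thetaDiffTerm {q : ℂ} (hq : ‖q‖ < 1) (a b : ℂ) :
    (a - b) * ∑' n, thetaDiffTerm q a b n = partialTheta q b - partialTheta q a := by
  have h1 := ((summable_thetaProdTerm hq (a * q) b).hasSum.mul_left a).sub
    ((summable_thetaProdTerm hq a (b * q)).hasSum.mul_left b)
  have h2 := (summable_thetaDiffTerm hq a b).hasSum.mul_left (a - b)
  simp only [sub_mul_thetaDiffTerm hq] at h2
  rw [h2.unique h1]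
  change a * thetaProd q (a * q) b - b * thetaProd q a (b * q) = _
  rw [thetaProd_eq_mul hq, thetaProd_eq_mul hq]
  linear_combination partialTheta q b * partialTheta_eq hq a
    - partialTheta q a * partialTheta_eq hq b

theorem sub_mul_tsum_geom_sum₂ {q : ℂ} (hq : ‖q‖ < 1) (a b : ℂ) :
    (a - b) * ∑' n : ℕ, (-1) ^ (n + 1) * q ^ n.choose 2 *
      ∑ i ∈ Finset.range n, a ^ i * b ^ (n - 1 - i) = partialTheta q b - partialTheta q a := by
  rw [← tsum_mul_left]
  unfold partialTheta
  rw [← (summable_partialTheta hq b).tsum_sub (summable_partialTheta hq a)]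
  refine tsum_congr fun n => ?_
  have h := geom_sum₂_mul a b n
  rw [neg_pow a, neg_pow b]
  linear_combination ((-1) ^ (n + 1) * q ^ n.choose 2) * h

/-- The derivative of the partial theta function at `-1` as a series of products; it is reached as
the limit `a → -1` of divided differences. -/
theorem tsum_thetaDiffTerm_neg_one {q : ℂ} (hq : ‖q‖ < 1) :
    ∑' n, thetaDiffTerm q (-1) (-1) n = ∑' n : ℕ, (n : ℂ) * q ^ n.choose 2 := by
  have hnear : ∀ᶠ x : ℂ in 𝓝 (-1), ‖x‖ < 2 :=
    continuous_norm.continuousAt.eventually_lt continuousAt_const (by norm_num)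
  have hL : Tendsto (fun a => ∑' n, thetaDiffTerm q a (-1) n) (𝓝 (-1))
      (𝓝 (∑' n, thetaDiffTerm q (-1) (-1) n)) := by
    refine tendsto_tsum_of_dominated_convergence
      ((summable_geometric_of_lt_one (norm_nonneg q) hq).mul_right _) (fun n => ?_)
      (hnear.mono fun x hx n => norm_thetaDiffTerm_le (S := 1) hq hx.le (by simp) n)
    have h1 := continuous_qPochInf hq
    have h2 := continuous_qPoch q n
    refine Continuous.tendsto (f := fun a => thetaDiffTerm q a (-1) n) ?_ _
    unfold thetaDiffTerm
    fun_prop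
  have hR : Tendsto (fun a : ℂ => ∑' n : ℕ, (-1) ^ (n + 1) * q ^ n.choose 2 *
      ∑ i ∈ Finset.range n, a ^ i * (-1) ^ (n - 1 - i)) (𝓝 (-1))
      (𝓝 (∑' n : ℕ, (-1) ^ (n + 1) * q ^ n.choose 2 *
        ∑ i ∈ Finset.range n, (-1) ^ i * (-1) ^ (n - 1 - i))) := by
    refine tendsto_tsum_of_dominated_convergence (summable_mul_pow_mul_pow_choose hq 2)
      (fun n => Continuous.tendsto (by fun_prop) _) (hnear.mono fun x hx n => ?_)
    have h1 : ‖∑ i ∈ Finset.range n, x ^ i * (-1) ^ (n - 1 - i)‖ ≤ n * 2 ^ n := by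
      refine (norm_sum_le _ _).trans
        ((Finset.sum_le_card_nsmul _ _ (2 ^ n) fun i hi => ?_).trans ?_)
      · rw [norm_mul, norm_pow, norm_pow, norm_neg, norm_one, one_pow, mul_one]
        calc ‖x‖ ^ i ≤ 2 ^ i := by gcongr
          _ ≤ 2 ^ n := pow_le_pow_right₀ (by norm_num) (Finset.mem_range.mp hi).le
      · simp
    rw [norm_mul, norm_mul, norm_pow, norm_neg, norm_one, one_pow, one_mul, norm_pow,
      mul_comm]
    gcongr
    refine h1.trans ?_
    gcongr
    linarith
  have heq : ∀ᶠ a : ℂ in 𝓝[≠] (-1), ∑' n : ℕ, (-1) ^ (n + 1) * q ^ n.choose 2 *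
      ∑ i ∈ Finset.range n, a ^ i * (-1) ^ (n - 1 - i) = ∑' n, thetaDiffTerm q a (-1) n := by
    filter_upwards [self_mem_nhdsWithin] with a ha
    refine mul_left_cancel₀ (sub_ne_zero.mpr ha) ?_
    rw [sub_mul_tsum_thetaDiffTerm hq, sub_mul_tsum_geom_sum₂ hq]
  rw [tendsto_nhds_unique (hL.mono_left nhdsWithin_le_nhds)
    ((hR.mono_left nhdsWithin_le_nhds).congr' heq)]
  refine tsum_congr fun n => ?_
  have h1 : ∀ i ∈ Finset.range n, (-1 : ℂ) ^ i * (-1) ^ (n - 1 - i) = (-1) ^ (n - 1) := by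
    intro i hi
    rw [← pow_add]
    congr 1
    have := Finset.mem_range.mp hi
    omega
  rw [Finset.sum_congr rfl h1, Finset.sum_const, Finset.card_range, nsmul_eq_mul]
  cases n with
  | zero => simp
  | succ n =>
    have h2 : (-1 : ℂ) ^ n * (-1) ^ n = 1 := by rw [← mul_pow]; simp
    rw [Nat.add_sub_cancel, pow_succ, pow_succ]
    linear_combination (((n + 1 : ℕ) : ℂ) * q ^ (n + 1).choose 2) * h2

/-! ### Gauss's product for the sum over triangular numbers -/

theorem summable_pow_mul_qPochInf {q x : ℂ} (hq : ‖q‖ < 1) (hx : ‖x‖ < 1) :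
    Summable fun n : ℕ => x ^ n * qPochInf (q ^ (n + 1)) q := by
  refine ((summable_geometric_of_lt_one (norm_nonneg x) hx).mul_right
    (Real.exp (1 / (1 - ‖q‖)))).of_norm_bounded fun n => ?_
  rw [norm_mul, norm_pow]
  gcongr
  exact norm_qPochInf_le hq (by rw [norm_pow]; exact pow_le_one₀ (norm_nonneg q) hq.le)

theorem one_sub_mul_tsum_pow_mul_qPochInf {q x : ℂ} (hq : ‖q‖ < 1) (hx : ‖x‖ < 1) :
    (1 - x) * ∑' n : ℕ, x ^ n * qPochInf (q ^ (n + 1)) q =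
      ∑' n : ℕ, (x * q) ^ n * qPochInf (q ^ (n + 1)) q := by
  have hxq : ‖x * q‖ < 1 := by
    rw [norm_mul]
    exact mul_lt_one_of_nonneg_of_lt_one_left (norm_nonneg x) hx hq.le
  have h1 := summable_pow_mul_qPochInf hq hx
  have h2 := summable_pow_mul_qPochInf hq hxq
  have h3 : ∑' n : ℕ, (x ^ n * qPochInf (q ^ (n + 1)) q -
      (x * q) ^ n * qPochInf (q ^ (n + 1)) q) = x * ∑' n : ℕ, x ^ n * qPochInf (q ^ (n + 1)) q := by
    rw [(h1.sub h2).tsum_eq_zero_add, ← tsum_mul_left]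
    simp only [pow_zero, sub_self, zero_add]
    refine tsum_congr fun n => ?_
    rw [qPochInf_eq_mul (q ^ (n + 1)) hq, ← pow_succ]
    ring
  rw [h1.tsum_sub h2] at h3
  linear_combination h3

/-- Euler's expansion `1 / (x; q)_∞ = ∑ x^n / (q; q)_n`, cleared of denominators. -/
theorem qPochInf_mul_tsum_pow_mul_qPochInf {q x : ℂ} (hq : ‖q‖ < 1) (hx : ‖x‖ < 1) :
    qPochInf x q * ∑' n : ℕ, x ^ n * qPochInf (q ^ (n + 1)) q = qPochInf q q := by
  have hxq : ∀ N : ℕ, ‖x * q ^ N‖ < 1 := fun N =>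
    (norm_mul_pow_le hq le_rfl N).trans_lt hx
  have h1 : ∀ N : ℕ, qPoch x q N * ∑' n : ℕ, x ^ n * qPochInf (q ^ (n + 1)) q =
      ∑' n : ℕ, (x * q ^ N) ^ n * qPochInf (q ^ (n + 1)) q := by
    intro N
    induction N with
    | zero => simp
    | succ N ih =>
      rw [qPoch_succ, mul_right_comm, ih, mul_comm,
        one_sub_mul_tsum_pow_mul_qPochInf hq (hxq N), mul_assoc x, ← pow_succ]
  have h2 : Tendsto (fun N : ℕ => ∑' n : ℕ, (x * q ^ N) ^ n * qPochInf (q ^ (n + 1)) q) atTop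
      (𝓝 (∑' n : ℕ, (0 : ℂ) ^ n * qPochInf (q ^ (n + 1)) q)) := by
    refine tendsto_tsum_of_dominated_convergence ((summable_geometric_of_lt_one
      (norm_nonneg x) hx).mul_right (Real.exp (1 / (1 - ‖q‖)))) (fun n => ?_)
      (Eventually.of_forall fun N n => ?_)
    · have h3 : Tendsto (fun N : ℕ => x * q ^ N) atTop (𝓝 0) := by
        simpa using (tendsto_pow_atTop_nhds_zero_of_norm_lt_one hq).const_mul x
      exact (h3.pow n).mul_const _
    · rw [norm_mul, norm_pow]
      gcongr
      · exact norm_mul_pow_le hq le_rfl N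
      · exact norm_qPochInf_le hq (by rw [norm_pow]; exact pow_le_one₀ (norm_nonneg q) hq.le)
  have h3 : ∑' n : ℕ, (0 : ℂ) ^ n * qPochInf (q ^ (n + 1)) q = qPochInf q q := by
    rw [tsum_eq_single 0 fun n hn => by simp [hn]]
    simp
  rw [h3] at h2
  exact tendsto_nhds_unique ((tendsto_qPoch_qPochInf x hq).mul_const _)
    (h2.congr fun N => (h1 N).symm)

theorem norm_sq_lt_one {q : ℂ} (hq : ‖q‖ < 1) : ‖q ^ 2‖ < 1 := by
  rw [norm_pow]; exact pow_lt_one₀ (norm_nonneg q) hq two_ne_zero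

theorem qPochInf_mul_qPochInf_neg {q : ℂ} (hq : ‖q‖ < 1) (a : ℂ) :
    qPochInf a q * qPochInf (-a) q = qPochInf (a ^ 2) (q ^ 2) := by
  unfold qPochInf
  rw [← (multipliable_qPochInf a q hq).tprod_mul (multipliable_qPochInf (-a) q hq)]
  refine tprod_congr fun j => ?_
  rw [← pow_mul, mul_comm 2 j, pow_mul]
  ring

theorem qPochInf_mul_qPochInf_sq {q : ℂ} (hq : ‖q‖ < 1) (a : ℂ) :
    qPochInf a (q ^ 2) * qPochInf (a * q) (q ^ 2) = qPochInf a q := by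
  have h1 := multipliable_qPochInf a (q ^ 2) (norm_sq_lt_one hq)
  have h2 := multipliable_qPochInf (a * q) (q ^ 2) (norm_sq_lt_one hq)
  have e1 : ∀ k : ℕ, 1 - a * (q ^ 2) ^ k = 1 - a * q ^ (2 * k) := fun k => by rw [← pow_mul]
  have e2 : ∀ k : ℕ, 1 - a * q * (q ^ 2) ^ k = 1 - a * q ^ (2 * k + 1) := fun k => by
    rw [← pow_mul, pow_succ]; ring
  unfold qPochInf
  rw [tprod_congr e1, tprod_congr e2]
  exact tprod_even_mul_odd (f := fun j => 1 - a * q ^ j) (h1.congr e1) (h2.congr e2)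

theorem qPochInf_ne_zero {q a : ℂ} (hq : ‖q‖ < 1) (ha : ‖a‖ < 1) : qPochInf a q ≠ 0 := by
  have h := tprod_one_add_ne_zero_of_summable (f := fun j : ℕ => -(a * q ^ j)) (fun j h => ?_) ?_
  · simp only [← sub_eq_add_neg] at h
    exact h
  · have h1 : ‖a * q ^ j‖ < 1 := (norm_mul_pow_le hq le_rfl j).trans_lt ha
    rw [← sub_eq_add_neg, sub_eq_zero] at h
    rw [← h, norm_one] at h1
    exact lt_irrefl _ h1
  · simp only [norm_neg, norm_mul, norm_pow]
    exact (summable_geometric_of_lt_one (norm_nonneg q) hq).mul_left _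

/-- Gauss's identity `(q;q)_∞ (-q;q)_∞^2 = ∑ q^{n(n+1)/2}`. -/
theorem gauss_triangular {q : ℂ} (hq : ‖q‖ < 1) :
    qPochInf q q * qPochInf (-q) q ^ 2 = partialTheta q (-q) := by
  have hq2 := norm_sq_lt_one hq
  have h0 : partialTheta q 0 = 1 := by rw [partialTheta_eq hq, zero_mul, sub_zero]
  have h1 : partialTheta q (-q) = ∑' n : ℕ, q ^ n * qPochInf ((q ^ 2) ^ (n + 1)) (q ^ 2) := by
    rw [← mul_one (partialTheta q (-q)), ← h0, ← thetaProd_eq_mul hq]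
    refine tsum_congr fun n => ?_
    have e : -q * q ^ n = -q ^ (n + 1) := by ring
    simp only [thetaProdTerm, e, zero_mul, mul_zero, qPoch_zero_left, qPochInf_zero_left, mul_one]
    rw [mul_assoc, qPochInf_mul_qPochInf_neg hq, ← pow_mul, ← pow_mul, mul_comm 2]
  have h2 := qPochInf_mul_tsum_pow_mul_qPochInf hq2 hq
  rw [← h1] at h2
  have h3 := qPochInf_mul_qPochInf_neg hq q
  have h4 := qPochInf_mul_qPochInf_sq hq q
  rw [← sq] at h4
  have h5 := qPochInf_ne_zero hq2 hq2
  have h6 := qPochInf_ne_zero hq2 hq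
  -- Euler's `(q; q²)_∞ (-q; q)_∞ = 1` follows from `h3` and `h4`.
  refine mul_left_cancel₀ (mul_ne_zero h5 h6) ?_
  rw [← h4] at h3 ⊢
  linear_combination (qPochInf q (q ^ 2) * qPochInf (q ^ 2) (q ^ 2) * qPochInf (-q) q
    + qPochInf (q ^ 2) (q ^ 2)) * h3 - qPochInf (q ^ 2) (q ^ 2) * h2

/-! ### The analytic identity -/

theorem triangular_eq_choose (n : ℕ) : n * (n + 1) / 2 = (n + 1).choose 2 := by
  rw [Nat.choose_two_right, Nat.add_sub_cancel, mul_comm]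

theorem summable_mul_pow_triangular {q : ℂ} (hq : ‖q‖ < 1) :
    Summable fun n : ℕ => (n : ℂ) * q ^ (n * (n + 1) / 2) := by
  have h := (summable_nat_add_iff 1).mpr (summable_mul_pow_mul_pow_choose hq 1)
  refine h.of_norm_bounded fun n => ?_
  rw [norm_mul, norm_pow, triangular_eq_choose, Complex.norm_natCast, one_pow, mul_one]
  gcongr
  push_cast
  linarith

theorem thetaDiffTerm_neg_one (q : ℂ) (n : ℕ) :
    thetaDiffTerm q (-1) (-1) n = q ^ n * qPochInf (-q ^ (n + 1)) q ^ 2 *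
      qPochInf (q ^ (n + 1)) q * qPoch (q ^ n) q n := by
  simp only [thetaDiffTerm, neg_mul, one_mul, neg_neg]
  ring

theorem tsum_pnat_thetaDiffTerm {q : ℂ} (hq : ‖q‖ < 1) :
    ∑' n : ℕ+, thetaDiffTerm q (-1) (-1) n =
      ∑' n : ℕ+, (n : ℂ) * q ^ ((n : ℕ) * ((n : ℕ) + 1) / 2) := by
  have hs := summable_mul_pow_triangular hq
  rw [tsum_pnat_eq_tsum_succ (f := fun n => thetaDiffTerm q (-1) (-1) n),
    tsum_pnat_eq_tsum_succ (f := fun n : ℕ => (n : ℂ) * q ^ (n * (n + 1) / 2))]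
  have h1 := (summable_thetaDiffTerm hq (-1) (-1)).tsum_eq_zero_add
  have h2 := hs.tsum_eq_zero_add
  have h3 : partialTheta q (-q) = ∑' n : ℕ, q ^ (n * (n + 1) / 2) := by
    refine tsum_congr fun n => ?_
    rw [neg_neg, ← pow_add, triangular_eq_choose, Nat.choose_succ_succ' n 1, Nat.choose_one_right]
  have h3' : Summable fun n : ℕ => q ^ (n * (n + 1) / 2) := by
    refine (summable_partialTheta hq (-q)).congr fun n => ?_
    rw [neg_neg, ← pow_add, triangular_eq_choose, Nat.choose_succ_succ' n 1, Nat.choose_one_right]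
  have h4 : ∑' n : ℕ, (n : ℂ) * q ^ n.choose 2 =
      ∑' n : ℕ, (n : ℂ) * q ^ (n * (n + 1) / 2) + partialTheta q (-q) := by
    have hs' : Summable fun n : ℕ => (n : ℂ) * q ^ n.choose 2 := by
      refine (summable_nat_add_iff 1).mp ((hs.add h3').congr fun n => ?_)
      rw [triangular_eq_choose]
      push_cast
      ring
    rw [h3, ← hs.tsum_add h3', hs'.tsum_eq_zero_add]
    simp only [Nat.cast_zero, zero_mul, zero_add]
    refine tsum_congr fun n => ?_
    rw [triangular_eq_choose]
    push_cast
    ring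
  have h5 : thetaDiffTerm q (-1) (-1) 0 = partialTheta q (-q) := by
    rw [thetaDiffTerm_neg_one, ← gauss_triangular hq]
    simp only [zero_add, pow_zero, pow_one, qPoch_zero]
    ring
  rw [tsum_thetaDiffTerm_neg_one hq, h4, h5] at h1
  simp only [Nat.cast_zero, zero_mul, zero_add] at h2
  rw [← h2]
  linear_combination -h1

/-! ### Counting overpartition pairs -/

/-- The weight of a finite set of parts that must satisfy `P`, where each part `p` contributes
`e q^p`; the weight vanishes if some part violates `P`. -/
noncomputable def partsWeight (q e : ℂ) (P : ℕ → Prop) [DecidablePred P] (A : Finset ℕ) : ℂ :=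
  ∏ p ∈ A, if P p then e * q ^ p else 0

theorem partsWeight_eq (q e : ℂ) (P : ℕ → Prop) [DecidablePred P] (A : Finset ℕ) :
    partsWeight q e P A = if ∀ p ∈ A, P p then e ^ A.card * q ^ ∑ p ∈ A, p else 0 := by
  rw [partsWeight, Finset.prod_ite_zero, Finset.prod_mul_distrib, Finset.prod_const,
    Finset.prod_pow_eq_pow_sum]

theorem norm_partsWeight_le {q e : ℂ} (he : ‖e‖ = 1) (P : ℕ → Prop) [DecidablePred P]
    (A : Finset ℕ) : ‖partsWeight q e P A‖ ≤ ∏ p ∈ A, ‖q‖ ^ p := by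
  rw [partsWeight, norm_prod]
  refine Finset.prod_le_prod (fun _ _ => norm_nonneg _) fun p _ => ?_
  split_ifs
  · rw [norm_mul, he, one_mul, norm_pow]
  · simp

theorem summable_prod_pow {r : ℝ} (h0 : 0 ≤ r) (h1 : r < 1) :
    Summable fun A : Finset ℕ => ∏ p ∈ A, r ^ p :=
  summable_finsetProd_of_summable_nonneg (fun _ => pow_nonneg h0 _)
    (summable_geometric_of_lt_one h0 h1)

theorem summable_norm_partsWeight {q e : ℂ} (hq : ‖q‖ < 1) (he : ‖e‖ = 1) (P : ℕ → Prop)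
    [DecidablePred P] : Summable fun A => ‖partsWeight q e P A‖ :=
  (summable_prod_pow (norm_nonneg q) hq).of_nonneg_of_le (fun _ => norm_nonneg _)
    fun A => norm_partsWeight_le he P A

theorem tsum_partsWeight {q e : ℂ} (hq : ‖q‖ < 1) (he : ‖e‖ = 1) (P : ℕ → Prop)
    [DecidablePred P] :
    ∑' A, partsWeight q e P A = ∏' p : ℕ, (1 + if P p then e * q ^ p else 0) :=
  (tprod_one_add (summable_norm_partsWeight hq he P).of_norm).symm

theorem tsum_partsWeight_gt {q e : ℂ} (hq : ‖q‖ < 1) (he : ‖e‖ = 1) (s : ℕ) :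
    ∑' A, partsWeight q e (fun p => s < p) A = qPochInf (-e * q ^ (s + 1)) q := by
  rw [tsum_partsWeight hq he, qPochInf, ← (add_left_injective (s + 1)).tprod_eq]
  · refine tprod_congr fun j => ?_
    rw [if_pos (by omega), pow_add]
    ring
  · intro p hp
    rw [Function.mem_mulSupport] at hp
    have : s < p := by
      by_contra h
      exact hp (by rw [if_neg h, add_zero])
    exact ⟨p - (s + 1), by simp only; omega⟩

theorem tsum_partsWeight_Ico {q : ℂ} (hq : ‖q‖ < 1) (s : ℕ) :
    ∑' A, partsWeight q (-1) (fun p => s ≤ p ∧ p < 2 * s) A = qPoch (q ^ s) q s := by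
  rw [tsum_partsWeight hq (by simp), tprod_eq_prod (s := Finset.Ico s (2 * s)),
    Finset.prod_Ico_eq_prod_range, show 2 * s - s = s by omega, qPoch]
  · refine Finset.prod_congr rfl fun j hj => ?_
    have := Finset.mem_range.mp hj
    rw [if_pos (by omega), pow_add]
    ring
  · intro p hp
    rw [if_neg (by simpa using hp), add_zero]

/-- The data that determine a pair counted by `pairsA`: the smallest part, then the remaining
overlined parts and the non-overlined parts of the first component, then the overlined and the
non-overlined parts of the second component. -/
abbrev PairData := ℕ+ × Finset ℕ × Finset ℕ × Finset ℕ × Finset ℕ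

namespace PairData

/-- The restrictions on the parts in terms of the smallest one. -/
def Admissible (j : PairData) : Prop :=
  (∀ p ∈ j.2.1, (j.1 : ℕ) < p) ∧ (∀ p ∈ j.2.2.1, (j.1 : ℕ) < p) ∧
    (∀ p ∈ j.2.2.2.1, (j.1 : ℕ) < p) ∧ ∀ p ∈ j.2.2.2.2, (j.1 : ℕ) ≤ p ∧ p < 2 * (j.1 : ℕ)

/-- The sum of all parts. -/
def size (j : PairData) : ℕ+ :=
  ⟨j.1 + (∑ p ∈ j.2.1, p + (∑ p ∈ j.2.2.1, p + (∑ p ∈ j.2.2.2.1, p + ∑ p ∈ j.2.2.2.2, p))),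
    Nat.add_pos_left j.1.pos _⟩

/-- The signed weight `± q^size` of admissible data, and `0` for other data. -/
noncomputable def weight (q : ℂ) (j : PairData) : ℂ :=
  q ^ (j.1 : ℕ) * (partsWeight q 1 (fun p => (j.1 : ℕ) < p) j.2.1 *
    (partsWeight q (-1) (fun p => (j.1 : ℕ) < p) j.2.2.1 *
      (partsWeight q 1 (fun p => (j.1 : ℕ) < p) j.2.2.2.1 *
        partsWeight q (-1) (fun p => (j.1 : ℕ) ≤ p ∧ p < 2 * (j.1 : ℕ)) j.2.2.2.2)))

theorem weight_of_admissible (q : ℂ) {j : PairData} (h : j.Admissible) :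
    weight q j = (-1) ^ (j.2.2.1.card + j.2.2.2.2.card) * q ^ (j.size : ℕ) := by
  obtain ⟨h1, h2, h3, h4⟩ := h
  simp only [weight, partsWeight_eq, if_pos h1, if_pos h2, if_pos h3, if_pos h4, size,
    PNat.mk_coe, pow_add, one_pow]
  ring

theorem admissible_of_weight_ne_zero {q : ℂ} {j : PairData} (h : weight q j ≠ 0) :
    j.Admissible := by
  simp only [weight, partsWeight_eq, ne_eq, mul_eq_zero, not_or, ite_eq_right_iff] at h
  obtain ⟨-, h1, h2, h3, h4⟩ := h
  refine ⟨?_, ?_, ?_, ?_⟩ <;> by_contra hc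
  exacts [h1 fun h => absurd h hc, h2 fun h => absurd h hc, h3 fun h => absurd h hc,
    h4 fun h => absurd h hc]

theorem summable_weight {q : ℂ} (hq : ‖q‖ < 1) : Summable (weight q) := by
  have hG := summable_prod_pow (norm_nonneg q) hq
  have hG0 : 0 ≤ fun A : Finset ℕ => ∏ p ∈ A, ‖q‖ ^ p :=
    fun A => Finset.prod_nonneg fun _ _ => by positivity
  have hs : Summable fun s : ℕ+ => ‖q‖ ^ (s : ℕ) :=
    (summable_geometric_of_lt_one (norm_nonneg q) hq).comp_injective PNat.coe_injective
  have h2 := hG.mul_of_nonneg hG hG0 hG0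
  have h20 : 0 ≤ fun x : Finset ℕ × Finset ℕ => (∏ p ∈ x.1, ‖q‖ ^ p) * ∏ p ∈ x.2, ‖q‖ ^ p :=
    fun x => mul_nonneg (hG0 _) (hG0 _)
  have h3 := hG.mul_of_nonneg h2 hG0 h20
  have h30 := fun x : Finset ℕ × Finset ℕ × Finset ℕ => mul_nonneg (hG0 x.1) (h20 x.2)
  have h4 := hG.mul_of_nonneg h3 hG0 h30
  have h40 := fun x : Finset ℕ × Finset ℕ × Finset ℕ × Finset ℕ =>
    mul_nonneg (hG0 x.1) (h30 x.2)
  have h5 := hs.mul_of_nonneg h4 (fun s => pow_nonneg (norm_nonneg q) _) h40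
  refine h5.of_norm_bounded fun j => ?_
  simp only [weight, norm_mul, norm_pow]
  gcongr <;> exact norm_partsWeight_le (by simp) _ _

theorem tsum_weight {q : ℂ} (hq : ‖q‖ < 1) :
    ∑' j, weight q j = ∑' s : ℕ+, q ^ (s : ℕ) * qPochInf (-q ^ ((s : ℕ) + 1)) q ^ 2 *
      qPochInf (q ^ ((s : ℕ) + 1)) q * qPoch (q ^ (s : ℕ)) q s := by
  rw [(summable_weight hq).tsum_prod]
  refine tsum_congr fun s => ?_
  have n1 : ‖(1 : ℂ)‖ = 1 := norm_one
  have n2 : ‖(-1 : ℂ)‖ = 1 := by simp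
  have s1 := summable_norm_partsWeight hq n1 fun p => (s : ℕ) < p
  have s2 := summable_norm_partsWeight hq n2 fun p => (s : ℕ) < p
  have s3 := summable_norm_partsWeight hq n2 fun p => (s : ℕ) ≤ p ∧ p < 2 * (s : ℕ)
  have m1 := s1.mul_norm s3
  have m2 := s2.mul_norm m1
  simp only [weight]
  rw [tsum_mul_left, ← tsum_mul_tsum_of_summable_norm s1 m2,
    ← tsum_mul_tsum_of_summable_norm s2 m1, ← tsum_mul_tsum_of_summable_norm s1 s3,
    tsum_partsWeight_gt hq n1, tsum_partsWeight_gt hq n2, tsum_partsWeight_Ico hq]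
  simp only [neg_neg, one_mul, neg_mul]
  ring

/-- The data of an overpartition pair; for pairs in `pairsA n` the infimum is the smallest part. -/
noncomputable def ofPair (π : OverpartitionPair) : PairData :=
  let s := sInf (π.1.overlined : Set ℕ)
  (s.toPNat', π.1.overlined.erase s, π.1.plain.toFinset, π.2.overlined, π.2.plain.toFinset)

theorem ofPair_eq {π : OverpartitionPair} {s : ℕ} (hs : s ∈ π.1.overlined)
    (hmin : ∀ p ∈ π.1.overlined, s ≤ p) :
    ofPair π = (⟨s, π.1.overlined_pos s hs⟩, π.1.overlined.erase s, π.1.plain.toFinset,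
      π.2.overlined, π.2.plain.toFinset) := by
  have h : sInf (π.1.overlined : Set ℕ) = s := IsLeast.csInf_eq ⟨hs, hmin⟩
  have hpos : s.toPNat' = ⟨s, π.1.overlined_pos s hs⟩ :=
    PNat.eq ((Nat.toPNat'_coe s).trans (if_pos (π.1.overlined_pos s hs)))
  simp only [ofPair, h, hpos]

theorem sum_toFinset_of_nodup {m : Multiset ℕ} (h : m.Nodup) : ∑ p ∈ m.toFinset, p = m.sum := by
  rw [Finset.sum_eq_multiset_sum, Multiset.toFinset_val, h.dedup, Multiset.map_id']

theorem bijOn_ofPair (n : ℕ+) :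
    Set.BijOn ofPair (pairsA n) {j | j.Admissible ∧ j.size = n} := by
  refine ⟨?_, ?_, ?_⟩
  · rintro π ⟨hsize, ⟨hd1, hd2⟩, s, -, ⟨-, hmin⟩, hs, h1, h2, h3⟩
    have hmin' : ∀ p ∈ π.1.overlined, s ≤ p := fun p hp =>
      hmin p (Multiset.mem_add.mpr (Or.inl hp))
    rw [ofPair_eq hs hmin']
    refine ⟨⟨fun p hp => ?_, fun p hp => h1 p (Multiset.mem_toFinset.mp hp), h2,
      fun p hp => h3 p (Multiset.mem_toFinset.mp hp)⟩, PNat.eq ?_⟩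
    · obtain ⟨hne, hp⟩ := Finset.mem_erase.mp hp
      exact lt_of_le_of_ne (hmin' p hp) hne.symm
    · rw [← hsize]
      have e := Finset.add_sum_erase π.1.overlined (fun p => p) hs
      simp only [size, PNat.mk_coe, sum_toFinset_of_nodup hd1, sum_toFinset_of_nodup hd2,
        OverpartitionPair.size, Overpartition.size, Overpartition.parts, Multiset.sum_add]
      simp only [Finset.sum_eq_multiset_sum, Multiset.map_id'] at e ⊢
      omega
  · rintro π ⟨-, ⟨hd1, hd2⟩, s, -, ⟨-, hmin⟩, hs, -⟩ ρ ⟨-, ⟨he1, he2⟩, t, -, ⟨-, hmin'⟩, ht, -⟩ h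
    rw [ofPair_eq hs fun p hp => hmin p (Multiset.mem_add.mpr (Or.inl hp)),
      ofPair_eq ht fun p hp => hmin' p (Multiset.mem_add.mpr (Or.inl hp))] at h
    have hst : s = t := congrArg (fun j : PairData => (j.1 : ℕ)) h
    have h1 : π.1.overlined.erase s = ρ.1.overlined.erase t :=
      congrArg (fun j : PairData => j.2.1) h
    have h2 : π.1.plain.toFinset = ρ.1.plain.toFinset := congrArg (fun j : PairData => j.2.2.1) h
    have h3 : π.2.overlined = ρ.2.overlined := congrArg (fun j : PairData => j.2.2.2.1) h
    have h4 : π.2.plain.toFinset = ρ.2.plain.toFinset :=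
      congrArg (fun j : PairData => j.2.2.2.2) h
    subst hst
    have e : ∀ a b : Multiset ℕ, a.Nodup → b.Nodup → a.toFinset = b.toFinset → a = b := by
      intro a b ha hb hab
      rw [← ha.dedup, ← hb.dedup, ← Multiset.toFinset_val, hab, Multiset.toFinset_val]
    refine Prod.ext (Overpartition.ext ?_ (e _ _ hd1 he1 h2))
      (Overpartition.ext h3 (e _ _ hd2 he2 h4))
    rw [← Finset.insert_erase hs, h1, Finset.insert_erase ht]
  · rintro ⟨s, A, B, C, D⟩ ⟨⟨hA, hB, hC, hD⟩, hsize⟩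
    have hsA : (s : ℕ) ∉ A := fun h => lt_irrefl _ (hA _ h)
    have hmin : ∀ p ∈ insert (s : ℕ) A, (s : ℕ) ≤ p := fun p hp => by
      rcases Finset.mem_insert.mp hp with rfl | hp
      exacts [le_rfl, (hA p hp).le]
    let π : OverpartitionPair :=
      (⟨insert (s : ℕ) A, B.val, fun p hp => s.pos.trans_le (hmin p hp),
        fun p hp => (Nat.zero_le _).trans_lt (hB p hp)⟩,
      ⟨C, D.val, fun p hp => (Nat.zero_le _).trans_lt (hC p hp),
        fun p hp => s.pos.trans_le (hD p hp).1⟩)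
    have hs : (s : ℕ) ∈ π.1.overlined := Finset.mem_insert_self _ _
    have hparts1 : ∀ p ∈ π.1.parts, (s : ℕ) ≤ p := fun p hp => by
      rcases Multiset.mem_add.mp hp with hp | hp
      exacts [hmin p hp, (hB p hp).le]
    have hparts2 : ∀ p ∈ π.2.parts, (s : ℕ) ≤ p := fun p hp => by
      rcases Multiset.mem_add.mp hp with hp | hp
      exacts [(hC p hp).le, (hD p hp).1]
    have hmem : (s : ℕ) ∈ π.1.parts := Multiset.mem_add.mpr (Or.inl hs)
    refine ⟨π, ⟨?_, ⟨B.nodup, D.nodup⟩, s, ⟨Multiset.mem_add.mpr (Or.inl hmem), fun p hp => ?_⟩,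
      ⟨hmem, hparts1⟩, hs, hB, hC, hD⟩, ?_⟩
    · rw [← hsize]
      have e := Finset.sum_insert (f := fun p => p) hsA
      simp only [size, PNat.mk_coe, π, OverpartitionPair.size, Overpartition.size,
        Overpartition.parts, Multiset.sum_add]
      simp only [Finset.sum_eq_multiset_sum, Multiset.map_id'] at e ⊢
      omega
    · rcases Multiset.mem_add.mp hp with hp | hp
      exacts [hparts1 p hp, hparts2 p hp]
    · rw [ofPair_eq hs hmin]
      simp only [π, Finset.erase_insert hsA, Finset.val_toFinset]
      rfl

theorem weight_ofPair (q : ℂ) {n : ℕ+} {π : OverpartitionPair} (hπ : π ∈ pairsA n) :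
    weight q (ofPair π) = (-1) ^ π.numPlain * q ^ (n : ℕ) := by
  obtain ⟨hadm, hsize⟩ := (bijOn_ofPair n).mapsTo hπ
  obtain ⟨-, ⟨hd1, hd2⟩, -⟩ := hπ
  rw [weight_of_admissible q hadm, hsize]
  simp only [ofPair, Multiset.card_toFinset, hd1.dedup, hd2.dedup, OverpartitionPair.numPlain]

end PairData

theorem signedA_eq_sum (n : ℕ) :
    signedA n = ∑ π ∈ (finite_pairsA n).toFinset, (-1) ^ OverpartitionPair.numPlain π := by
  classical
  have h : ∀ (P : ℕ → Prop) [DecidablePred P],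
      ({π ∈ pairsA n | P (OverpartitionPair.numPlain π)}.ncard : ℤ) =
        ∑ π ∈ (finite_pairsA n).toFinset, if P (OverpartitionPair.numPlain π) then 1 else 0 := by
    intro P _
    rw [Finset.sum_boole, ← Set.ncard_coe_finset, Finset.coe_filter]
    simp only [Set.Finite.mem_toFinset]
  rw [signedA, A₂, A₃, h Even, h Odd, ← Finset.sum_sub_distrib]
  refine Finset.sum_congr rfl fun π _ => ?_
  rcases Nat.even_or_odd (OverpartitionPair.numPlain π) with he | ho
  · rw [if_pos he, if_neg (Nat.not_odd_iff_even.mpr he), he.neg_one_pow, sub_zero]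
  · rw [if_neg (Nat.not_even_iff_odd.mpr ho), if_pos ho, ho.neg_one_pow, zero_sub]

theorem tsum_weight_fiber (q : ℂ) (n : ℕ+) :
    ∑' j : PairData.size ⁻¹' {n}, PairData.weight q j = (signedA n : ℂ) * q ^ (n : ℕ) := by
  have h1 := (PairData.bijOn_ofPair n)
  have h2 : ∑' j : PairData.size ⁻¹' {n}, PairData.weight q j =
      ∑' j : {j : PairData | j.Admissible ∧ j.size = n}, PairData.weight q j := by
    rw [tsum_subtype, tsum_subtype]
    refine tsum_congr fun j => ?_
    by_cases hj : j.size = n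
    · by_cases ha : j.Admissible
      · rw [Set.indicator_of_mem (by exact hj), Set.indicator_of_mem (by exact ⟨ha, hj⟩)]
      · rw [Set.indicator_of_mem (by exact hj), Set.indicator_of_notMem fun h => ha h.1]
        by_contra hw
        exact ha (PairData.admissible_of_weight_ne_zero hw)
    · rw [Set.indicator_of_notMem (by exact hj), Set.indicator_of_notMem fun h => hj h.2]
  rw [h2, ← (h1.equiv PairData.ofPair).tsum_eq]
  have h3 : ∀ π : pairsA n, PairData.weight q (h1.equiv PairData.ofPair π) =
      (-1) ^ OverpartitionPair.numPlain π * q ^ (n : ℕ) := fun π =>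
    PairData.weight_ofPair q π.2
  rw [tsum_congr h3, tsum_mul_right, signedA_eq_sum]
  push_cast
  rw [← Finset.tsum_subtype' (finite_pairsA n).toFinset
    (fun π => (-1 : ℂ) ^ OverpartitionPair.numPlain π), Set.Finite.coe_toFinset]

/-- The generating function of `signedA`, by grouping the weighted data according to size. -/
theorem hasSum_signedA {q : ℂ} (hq : ‖q‖ < 1) :
    HasSum (fun n : ℕ+ => (signedA n : ℂ) * q ^ (n : ℕ)) (∑' j, PairData.weight q j) := by
  simp only [← tsum_weight_fiber]
  exact (PairData.summable_weight hq).hasSum.tsum_fiberwise PairData.size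

theorem theorem3 (q : ℂ) (hq : ‖q‖ < 1) :
    (Summable (fun n : ℕ+ => (signedA n : ℂ) * q ^ (n : ℕ)) ∧
      Summable (fun n : ℕ+ => q ^ (n : ℕ) * qPochInf (-q ^ ((n : ℕ) + 1)) q ^ 2 *
        qPochInf (q ^ ((n : ℕ) + 1)) q * qPoch (q ^ (n : ℕ)) q n) ∧
      Summable (fun n : ℕ+ => (n : ℂ) * q ^ ((n : ℕ) * ((n : ℕ) + 1) / 2))) ∧
    ∑' n : ℕ+, (signedA n : ℂ) * q ^ (n : ℕ) =
      ∑' n : ℕ+, q ^ (n : ℕ) * qPochInf (-q ^ ((n : ℕ) + 1)) q ^ 2 *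
        qPochInf (q ^ ((n : ℕ) + 1)) q * qPoch (q ^ (n : ℕ)) q n ∧
    ∑' n : ℕ+, q ^ (n : ℕ) * qPochInf (-q ^ ((n : ℕ) + 1)) q ^ 2 *
        qPochInf (q ^ ((n : ℕ) + 1)) q * qPoch (q ^ (n : ℕ)) q n =
      ∑' n : ℕ+, (n : ℂ) * q ^ ((n : ℕ) * ((n : ℕ) + 1) / 2) := by
  refine ⟨⟨(hasSum_signedA hq).summable, ?_, ?_⟩, ?_, ?_⟩
  · simp only [← thetaDiffTerm_neg_one]
    exact (summable_thetaDiffTerm hq (-1) (-1)).comp_injective PNat.coe_injective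
  · exact (summable_mul_pow_triangular hq).comp_injective PNat.coe_injective
  · rw [(hasSum_signedA hq).tsum_eq, PairData.tsum_weight hq]
  · simp only [← thetaDiffTerm_neg_one]
    exact tsum_pnat_thetaDiffTerm hq
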